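/- Let $N\ge 1$ and let $W_n$ be the set of binary strings of length $n$. Let $\Gamma$ be the directed graph with vertex set $W_N$ in which $x\to y$ if and only if $y$ arises from $x$ by replacing the rightmost $0$ with $1$ or by replacing the rightmost $1$ with $0$ (so $0^N$ and $1^N$ have one direct successor each, all other vertices two), and let $\Gamma'$ be $\Gamma$ with a self-loop added at each of $0^N$ and $1^N$. Let $A_N$, $A_N'$ be the adjacency matrices of $\Gamma$, $\Gamma'$, acting on the space $\mathbb{C}^{W_N}$ by sending each vertex to the sum of its direct successors; equivalently $(A_Nc)_y=\sum_{x\to y}c_x$, and similarly for $A_N'$. Let $U_k$ be the Chebyshev polynomials of the second kind and let $S$ be the bitwise complement of strings. Every string $w$ has a unique form $w=0^{j_{k+1}}1^{j_k}0^{j_{k-1}}\cdots 0^{j_2}1^{j_1}$ with $k$ odd, $j_1,j_{k+1}\ge 0$ and $j_2,\dots,j_k\ge 1$; put $s_i=j_1+\cdots+j_i$. (1) If $\lambda\in\mathbb{C}$ is a root of some $U_m$ with $m\le N-1$, then $\lambda$ is an eigenvalue of both $\frac12A_N$ and $\frac12A_N'$, and these two matrices have the same eigenvectors for $\lambda$.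 Moreover, let $\ell\le N-2$ be such that $\lambda$ is a root of $U_{\ell+1}$ and not of $U_1,\dots,U_\ell$. Then for every $q\in W_{N-\ell-2}$ there is exactly one vector $c=c^{(q)}$ such that the components of $c$ at strings that do not begin with $q$ are zero and, for all $p\in W_\ell$, (i) $c_{(q00p)}=0$; (ii) $c_{(q100^\ell)}=1$; (iii) $c_{(q10p)}\prod_{i=1}^kU_{s_i}(\lambda)=1$, with $k$ and the $s_i$ taken from the form of $p$; (iv) $c_{(q11p)}=0$ and $c_{(q01p)}=-U_\ell(\lambda)\,c_{(q10S(p))}$. Each $c^{(q)}$ is an eigenvector of both $\frac12A_N$ and $\frac12A_N'$ for $\lambda$, and the vectors $c^{(q)}$, $q\in W_{N-\ell-2}$, form a basis of the common eigenspace of the two matrices for $\lambda$. (2) If $\lambda\in\mathbb{C}$ is a root of $U_N$ and not of $U_1,\dots,U_{N-1}$, then there is exactly one vector $c$ with (j) $c_{(0^N)}=1$; (jj) $c_{(q)}\prod_{i=1}^kU_{s_i}(\lambda)=1$ for every $q\in W_N$ whose form has $j_{k+1}\ge1$ (that is, $q$ begins with $0$); and $c_{(S(q))}=-U_{N-1}(\lambda)\,c_{(q)}$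 for all $q\in W_N$. It is an eigenvector of $\frac12A_N'$ for $\lambda$, and it spans the eigenspace. (3) There is exactly one vector $c$ with $c_{(q)}\prod_{i=1}^k(1+s_i)=1$ for every $q\in W_N$ whose form has $j_{k+1}\ge1$, and $c_{(S(q))}=c_{(q)}$ for all $q\in W_N$. It is an eigenvector of $\frac12A_N'$ for the eigenvalue $1$, and it spans the eigenspace. -/

import Mathlib

namespace HysteresisGraph

/-- Binary strings `(x_0, …, x_{N-1})` of length `N`; `false` is the symbol `0`, `true` is `1`.
As a list, the string is `List.ofFn x`, with `x_0` as the leftmost symbol. -/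
abbrev Word (N : ℕ) : Type := Fin N → Bool

/-- The symmetry `S`, exchanging `0` and `1` everywhere in a string. -/
def bitFlip {N : ℕ} (x : Word N) : Word N := fun i => !x i

/-- Directed edges `x → y` of the graph `Γ`: `y` is obtained from `x` by replacing the rightmost
`0` with `1`, or the rightmost `1` with `0`. (The constant strings `0…0` and `1…1` thus have only
one direct successor, all other strings have two.) -/
def Edge {N : ℕ} (x y : Word N) : Prop :=
  (∃ i, x i = false ∧ (∀ k, i < k → x k = true) ∧ y = Function.update x i true) ∨
  (∃ j, x j = true ∧ (∀ k, j < k → x k = false) ∧ y = Function.update x j false)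

/-- Directed edges of `Γ'`: those of `Γ` and self-loops at the two constant strings. -/
def Edge' {N : ℕ} (x y : Word N) : Prop :=
  Edge x y ∨ (x = (fun _ => false) ∧ y = x) ∨ (x = (fun _ => true) ∧ y = x)

instance {N : ℕ} (x y : Word N) : Decidable (Edge x y) := by
  unfold Edge; infer_instance

instance {N : ℕ} (x y : Word N) : Decidable (Edge' x y) := by
  unfold Edge'; infer_instance

/-- The adjacency matrix `A_N` of `Γ`. The column of a vertex `x` marks the direct successors of
`x`, so that the matrix sends the basis vector `x` to the sum of the successors of `x`; this is the
orientation of the recursion `A_{k+1} = (A_k, J_k; J_k', A_k)` with `J_k = diag(1,0,…,0)` and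
`J_k' = diag(0,…,0,1)`. -/
def A (N : ℕ) : Matrix (Word N) (Word N) ℂ :=
  Matrix.of fun y x => if Edge x y then 1 else 0

/-- The adjacency matrix `A'_N` of `Γ'`, in the same orientation. -/
def A' (N : ℕ) : Matrix (Word N) (Word N) ℂ :=
  Matrix.of fun y x => if Edge' x y then 1 else 0

/-- The operator `½ A_N` on `ℂ^(Word N)`. -/
noncomputable def halfA (N : ℕ) : Module.End ℂ (Word N → ℂ) :=
  Matrix.toLin' ((1 / 2 : ℂ) • A N)

/-- The operator `½ A'_N` on `ℂ^(Word N)`. -/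
noncomputable def halfA' (N : ℕ) : Module.End ℂ (Word N → ℂ) :=
  Matrix.toLin' ((1 / 2 : ℂ) • A' N)

/-- The value `U_n(z)` of the Chebyshev polynomial of the second kind. -/
noncomputable def chebU (n : ℕ) (z : ℂ) : ℂ :=
  (Polynomial.Chebyshev.U ℂ (n : ℤ)).eval z

/-- The string `… 0^{j_4} 1^{j_3} 0^{j_2} 1^{j_1}` with `n` blocks (odd blocks consist of `1`s and
even blocks of `0`s, numbered from the right). -/
def blockString (j : ℕ → ℕ) : ℕ → List Bool
  | 0 => []
  | n + 1 => List.replicate (j (n + 1)) (decide (Odd (n + 1))) ++ blockString j n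

/-- `w = 0^{j_{k+1}} 1^{j_k} 0^{j_{k-1}} ⋯ 0^{j_2} 1^{j_1}` with `j_1, j_{k+1} ≥ 0` and
`j_2, …, j_k ≥ 1`. -/
def IsBlockForm (w : List Bool) (k : ℕ) (j : ℕ → ℕ) : Prop :=
  Odd k ∧ (∀ i, 2 ≤ i → i ≤ k → 1 ≤ j i) ∧ w = blockString j (k + 1)

/-- The partial sums `s_i = j_1 + ⋯ + j_i`. -/
def partialSum (j : ℕ → ℕ) (i : ℕ) : ℕ := ∑ m ∈ Finset.Icc 1 i, j m

/-- The relations (i) -- (iv) for the vector labelled by the string `q` of length `N - ℓ - 2`; the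
components at strings that do not begin with `q` are zero. -/
structure IsPrefixVector (N ℓ : ℕ) (lam : ℂ) (q : Word (N - ℓ - 2)) (c : Word N → ℂ) : Prop where
  off_prefix : ∀ x : Word N, ¬ (List.ofFn q <+: List.ofFn x) → c x = 0
  rel_i : ∀ (x : Word N) (p : List Bool), p.length = ℓ →
    List.ofFn x = List.ofFn q ++ [false, false] ++ p → c x = 0
  rel_ii : ∀ x : Word N,
    List.ofFn x = List.ofFn q ++ [true, false] ++ List.replicate ℓ false → c x = 1
  rel_iii : ∀ (x : Word N) (p : List Bool) (k : ℕ) (j : ℕ → ℕ), p.length = ℓ → IsBlockForm p k j →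
    List.ofFn x = List.ofFn q ++ [true, false] ++ p →
      c x * ∏ i ∈ Finset.Icc 1 k, chebU (partialSum j i) lam = 1
  rel_iv_zero : ∀ (x : Word N) (p : List Bool), p.length = ℓ →
    List.ofFn x = List.ofFn q ++ [true, true] ++ p → c x = 0
  rel_iv_flip : ∀ (x y : Word N) (p : List Bool), p.length = ℓ →
    List.ofFn x = List.ofFn q ++ [false, true] ++ p →
    List.ofFn y = List.ofFn q ++ [true, false] ++ p.map not →
      c x = - chebU ℓ lam * c y

/-- The relations (j), (jj) together with `c_{S(q)} = -U_{N-1}(lam) c_q`. -/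
structure IsTopVector (N : ℕ) (lam : ℂ) (c : Word N → ℂ) : Prop where
  rel_j : c (fun _ => false) = 1
  rel_jj : ∀ (x : Word N) (k : ℕ) (j : ℕ → ℕ), IsBlockForm (List.ofFn x) k j → 1 ≤ j (k + 1) →
    c x * ∏ i ∈ Finset.Icc 1 k, chebU (partialSum j i) lam = 1
  rel_flip : ∀ x : Word N, c (bitFlip x) = - chebU (N - 1) lam * c x

/-- The relations for the components of the eigenvector with eigenvalue `1`. -/
structure IsStationaryVector (N : ℕ) (c : Word N → ℂ) : Prop where
  rel_prod : ∀ (x : Word N) (k : ℕ) (j : ℕ → ℕ), IsBlockForm (List.ofFn x) k j → 1 ≤ j (k + 1) →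
    c x * ∏ i ∈ Finset.Icc 1 k, (1 + (partialSum j i : ℂ)) = 1
  rel_flip : ∀ x : Word N, c (bitFlip x) = c x

end HysteresisGraph

/-! Splitting strings by their first symbol `b`, the graph on length `n + 1` is two copies of the
graph on length `n`, joined by two edges only: `(!b) bⁿ → b bⁿ` for each `b`. Hence an eigenvector
restricted to copy `b` solves the eigenvalue equation on length `n` with an extra inflow at the
single string `bⁿ`. Self-loops are inflows of the same kind. `Sol` records this problem with inflows
`α b` at the constant strings, and one-sided problems split into one-sided problems.

As long as `U_1, …, U_n` do not vanish at `lam`, a one-sided problem has a one-dimensional solution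
space, spanned by `fundSol`, and the inflow `a` and the value `X` at the entry string satisfy `a U_n
= X U_{n+1}` (`sol_single_iff`). The value at the opposite constant string is `X / U_n`, and the
induction closes by `U_{n+1}² = 1 + U_n U_{n+2}`. Unfolding `fundSol` along the blocks of a string
gives the product formula.

For `½ A'` on length `n + 1`, two one-sided problems are glued: the values at the two constant
strings are exchanged by the factor `ε = U_{n+1} - U_n`. This has a one-dimensional solution when
`ε² = 1`, which covers both a first root of `U_{n+1}` (`ε = -U_n`) and `lam = 1` (`ε = 1`).

If `U_{ℓ+1}` is the first to vanish, a one-sided problem on length `ℓ` admits no inflow. On length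
`ℓ + 2` this forces zeros at all strings `00p`, `11p` and leaves a line of solutions, vanishing at
both constant strings. For longer strings the joining edges and the self-loops therefore carry
nothing: the copies decouple, each prefix `q` contributes an independent line, and `½ A`, `½ A'`
have the same eigenspace (`sol_iff_isPrefixCombination`). -/

namespace HysteresisGraph

/-! ### Values of the Chebyshev polynomials -/

section Chebyshev

theorem chebU_zero (z : ℂ) : chebU 0 z = 1 := by simp [chebU]

theorem chebU_one (z : ℂ) : chebU 1 z = 2 * z := by simp [chebU]

theorem chebU_add_two (n : ℕ) (z : ℂ) :
    chebU (n + 2) z = 2 * z * chebU (n + 1) z - chebU n z := by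
  simp [chebU, Polynomial.Chebyshev.U_add_two]

/-- The Cassini identity of the recurrence: `U_{n+1}² - U_n U_{n+2}` does not depend on `n`. It
drives the induction for the one-sided problem and makes `U_n = ±1` at a root of `U_{n+1}`. -/
theorem chebU_succ_sq (n : ℕ) (z : ℂ) :
    chebU (n + 1) z ^ 2 = 1 + chebU n z * chebU (n + 2) z := by
  induction n with
  | zero => rw [chebU_add_two, chebU_zero, chebU_one]; ring
  | succ n ih =>
    rw [chebU_add_two (n + 1), chebU_add_two n] at *
    linear_combination ih

theorem chebU_at_one (n : ℕ) : chebU n 1 = n + 1 := by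
  simp [chebU]

end Chebyshev

/-! ### Recursive structure of the graph -/

section Edges

theorem edge_iff {N : ℕ} (x y : Word N) :
    Edge x y ↔ ∃ b i, x i = b ∧ (∀ k, i < k → x k = !b) ∧ y = Function.update x i (!b) := by
  rw [Bool.exists_bool]
  rfl

/-- The first symbol changes only if it is the rightmost occurrence of its value, that is, if all
later symbols are its complement; otherwise the move takes place in the tail. -/
theorem edge_cons {N : ℕ} (b b' : Bool) (x y : Word N) :
    Edge (Fin.cons b x : Word (N + 1)) (Fin.cons b' y) ↔
      (b = b' ∧ Edge x y) ∨ (b = !b' ∧ x = y ∧ y = fun _ => b') := by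
  simp only [edge_iff, Fin.exists_fin_succ, Fin.forall_fin_succ, Fin.cons_zero, Fin.cons_succ,
    Fin.update_cons_zero, ← Fin.cons_update, Fin.cons_inj, Fin.succ_lt_succ_iff]
  constructor
  · rintro ⟨d, ⟨hb, ⟨-, hx⟩, hb', hy⟩ | ⟨i, hi, ⟨-, hx⟩, hb, hy⟩⟩
    · right
      subst hb hb'
      refine ⟨by simp, hy.symm, ?_⟩
      rw [hy]
      funext k
      exact hx k (Fin.succ_pos k)
    · exact Or.inl ⟨hb.symm, d, i, hi, hx, hy⟩
  · rintro (⟨hb, d, i, hi, hx, hy⟩ | ⟨hb, hxy, hy⟩)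
    · exact ⟨d, Or.inr ⟨i, hi, ⟨fun h => absurd h (by simp), hx⟩, hb.symm, hy⟩⟩
    · subst hxy
      refine ⟨b, Or.inl ⟨rfl, ⟨fun h => absurd h (by simp), fun k _ => ?_⟩, by simp [hb], rfl⟩⟩
      rw [hy]; simp [hb]

theorem not_edge_self {N : ℕ} (x : Word N) : ¬ Edge x x := by
  rw [edge_iff]
  rintro ⟨b, i, hi, -, hx⟩
  have := congrFun hx i
  simp [hi] at this

theorem A_mulVec_cons {N : ℕ} (c : Word (N + 1) → ℂ) (b : Bool) (y : Word N) :
    (A (N + 1)).mulVec c (Fin.cons b y) =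
      (A N).mulVec (fun x => c (Fin.cons b x)) y +
        if y = (fun _ => b) then c (Fin.cons (!b) y) else 0 := by
  have key : (A (N + 1)).mulVec c (Fin.cons b y) =
      ∑ d : Bool, ∑ x : Word N,
        A (N + 1) (Fin.cons b y) (Fin.cons d x) * c (Fin.cons d x) := by
    rw [← Fintype.sum_prod_type']
    exact (Fintype.sum_equiv (Fin.consEquiv fun _ => Bool) _ _ fun _ => rfl).symm
  rw [key]
  have hb : ∀ f : Bool → ℂ, ∑ d, f d = f b + f (!b) := by
    intro f; cases b <;> simp [add_comm]
  rw [hb]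
  congr 1
  · simp [Matrix.mulVec, dotProduct, A, edge_cons]
  · have : ∀ x : Word N, A (N + 1) (Fin.cons b y) (Fin.cons (!b) x) * c (Fin.cons (!b) x) =
        if x = y then (if y = (fun _ => b) then c (Fin.cons (!b) y) else 0) else 0 := by
      intro x
      by_cases hx : x = y
      · subst hx; simp [A, edge_cons]
      · simp [A, edge_cons, hx]
    simp [this]

end Edges

/-! ### The eigenvalue equation with inflow at the constant strings -/

section BoundaryProblem

/-- The strings of length `n` satisfy the eigenvalue equation of `½ A_n` for `lam`, with the extra
inflow `α b` at the constant string `bⁿ`. -/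
def Sol (lam : ℂ) : ℕ → (List Bool → ℂ) → (Bool → ℂ) → Prop
  | 0, h, α => α false + α true = 2 * lam * h []
  | n + 1, h, α => ∀ b, Sol lam n (fun y => h (b :: y))
      (Pi.single b (α b + h ((!b) :: List.replicate n b)))

theorem sol_succ {lam : ℂ} {n : ℕ} {h : List Bool → ℂ} {α : Bool → ℂ} :
    Sol lam (n + 1) h α ↔ ∀ b, Sol lam n (fun y => h (b :: y))
      (Pi.single b (α b + h ((!b) :: List.replicate n b))) := Iff.rfl

/-- The recursion in `Sol` is `A_mulVec_cons` read copy by copy. On length `0` both constant strings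
are the empty string, so both inflows enter there. -/
theorem sol_iff_mulVec (lam : ℂ) (n : ℕ) (h : List Bool → ℂ) (α : Bool → ℂ) :
    Sol lam n h α ↔ ∀ y : Word n, (A n).mulVec (fun x => h (List.ofFn x)) y +
      ∑ b, (if y = (fun _ => b) then α b else 0) = 2 * lam * h (List.ofFn y) := by
  induction n generalizing h α with
  | zero =>
    have : A 0 = 0 := by
      ext x y
      simp [A, edge_iff]
    simp only [Sol, this, Matrix.zero_mulVec]
    simp only [Fintype.sum_bool, Pi.zero_apply, zero_add, List.ofFn_zero]
    constructor
    · intro H y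
      rw [if_pos (Subsingleton.elim _ _), if_pos (Subsingleton.elim _ _), add_comm, H]
    · intro H
      have := H (fun _ => true)
      rwa [if_pos (Subsingleton.elim _ _), if_pos (Subsingleton.elim _ _), add_comm] at this
  | succ n ih =>
    have hc : ∀ (b d : Bool) (y : Word n), (Fin.cons b y : Word (n + 1)) = (fun _ => d) ↔
        b = d ∧ y = fun _ => d := by
      intro b d y
      have : (fun _ => d : Word (n + 1)) = Fin.cons d (fun _ => d) := by
        funext i; refine Fin.cases rfl (fun _ => rfl) i
      rw [this, Fin.cons_inj]
    simp only [Sol, ih]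
    rw [Fin.forall_fin_succ_pi]
    refine forall_congr' fun b => forall_congr' fun y => ?_
    rw [A_mulVec_cons]
    simp only [List.ofFn_cons, hc]
    have e1 : ∑ d, (if y = (fun _ => d) then
        (Pi.single b (α b + h ((!b) :: List.replicate n b)) : Bool → ℂ) d else 0) =
        (if y = (fun _ => b) then h ((!b) :: List.ofFn y) else 0) +
          ∑ d, (if b = d ∧ y = (fun _ => d) then α d else 0) := by
      by_cases hy : y = fun _ => b
      · have hl : List.ofFn y = List.replicate n b := by rw [hy]; exact List.ofFn_const n b
        rw [hl]
        cases b <;> simp [hy, add_comm]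
      · cases b <;> simp [hy]
    rw [e1, add_assoc]

/-- A vector indexed by words, as a function on lists. -/
noncomputable def listExt {N : ℕ} (c : Word N → ℂ) : List Bool → ℂ :=
  Function.extend List.ofFn c 0

theorem listExt_ofFn {N : ℕ} (c : Word N → ℂ) (x : Word N) : listExt c (List.ofFn x) = c x :=
  List.ofFn_injective.extend_apply _ _ _

theorem exists_ofFn_eq {N : ℕ} {l : List Bool} (hl : l.length = N) :
    ∃ x : Word N, List.ofFn x = l := by
  subst hl
  exact ⟨l.get, List.ofFn_get l⟩

theorem mem_eigenspace_halfA {N : ℕ} {lam : ℂ} {c : Word N → ℂ} :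
    c ∈ (halfA N).eigenspace lam ↔ Sol lam N (listExt c) 0 := by
  rw [Module.End.mem_eigenspace_iff, sol_iff_mulVec, funext_iff]
  refine forall_congr' fun y => ?_
  simp only [halfA, Matrix.toLin'_apply, Matrix.smul_mulVec, listExt_ofFn, Pi.smul_apply,
    smul_eq_mul, Pi.zero_apply, ite_self, Finset.sum_const_zero, add_zero]
  constructor <;> intro h
  · linear_combination (2 : ℂ) * h
  · linear_combination (1 / 2 : ℂ) * h

/-- A self-loop at `bᴺ` is an inflow equal to the component there. For `N = 0` the two loops would
be one edge but count as two inflows. -/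
theorem mem_eigenspace_halfA' {N : ℕ} (hN : 1 ≤ N) {lam : ℂ} {c : Word N → ℂ} :
    c ∈ (halfA' N).eigenspace lam ↔ Sol lam N (listExt c) fun b => c fun _ => b := by
  rw [Module.End.mem_eigenspace_iff, sol_iff_mulVec, funext_iff]
  refine forall_congr' fun y => ?_
  have hA : (A' N).mulVec c y =
      (A N).mulVec c y + ∑ b, (if y = (fun _ => b) then c (fun _ => b) else 0) := by
    have hne : (fun _ => false : Word N) ≠ fun _ => true := fun h => by
      simpa using congrFun h ⟨0, hN⟩
    have hsum : ∑ b, (if y = (fun _ => b) then c (fun _ => b) else 0) =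
        ∑ x, if x = y then (∑ b, if y = (fun _ => b) then c (fun _ => b) else 0) else 0 := by
      simp
    rw [hsum]
    simp only [Matrix.mulVec, dotProduct]
    rw [← Finset.sum_add_distrib]
    refine Finset.sum_congr rfl fun x _ => ?_
    by_cases hx : x = y
    · subst hx
      have hE := not_edge_self x
      by_cases h0 : x = fun _ => false
      · simp [A, A', Edge', h0, hne]
        intro hh; exact absurd (h0 ▸ hE) (by simpa using hh)
      · by_cases h1 : x = fun _ => true
        · simp [A, A', Edge', h1, hne.symm]
          intro hh; exact absurd (h1 ▸ hE) (by simpa using hh)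
        · simp [A, A', Edge', hE, h0, h1]
    · have : Edge' x y ↔ Edge x y := by
        simp [Edge', Ne.symm hx]
      simp [A, A', this, hx]
  simp only [halfA', Matrix.toLin'_apply, Matrix.smul_mulVec, listExt_ofFn, Pi.smul_apply,
    smul_eq_mul, hA]
  constructor <;> intro h
  · linear_combination (2 : ℂ) * h
  · linear_combination (1 / 2 : ℂ) * h

end BoundaryProblem

/-! ### The one-sided boundary problem -/

section FundamentalSolution

/-- The solution of the boundary problem with inflow only at the constant string `fⁿ`, normalised
to be `1` there. -/
noncomputable def fundSol (lam : ℂ) : Bool → List Bool → ℂ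
  | _, [] => 1
  | f, b :: y =>
    if b = f then fundSol lam f y else fundSol lam (!f) y / chebU (y.length + 1) lam

variable {lam : ℂ}

theorem fundSol_cons_self (f : Bool) (y : List Bool) :
    fundSol lam f (f :: y) = fundSol lam f y := by
  simp [fundSol]

theorem fundSol_cons_not (f : Bool) (y : List Bool) :
    fundSol lam f ((!f) :: y) = fundSol lam (!f) y / chebU (y.length + 1) lam := by
  simp [fundSol]

theorem fundSol_replicate_append (f : Bool) (a : ℕ) (w : List Bool) :
    fundSol lam f (List.replicate a f ++ w) = fundSol lam f w := by
  induction a with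
  | zero => simp
  | succ a ih => rw [List.replicate_succ, List.cons_append, fundSol_cons_self, ih]

theorem fundSol_replicate (f : Bool) (n : ℕ) : fundSol lam f (List.replicate n f) = 1 := by
  simpa [fundSol] using fundSol_replicate_append (lam := lam) f n []

/-- The opposite constant string is where a copy feeds its sibling, so this value governs the
coupling. -/
theorem fundSol_replicate_not (f : Bool) (n : ℕ) :
    fundSol lam f (List.replicate n (!f)) = (chebU n lam)⁻¹ := by
  cases n with
  | zero => simp [fundSol, chebU_zero]
  | succ n =>
    rw [List.replicate_succ, fundSol_cons_not, fundSol_replicate]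
    simp

theorem fundSol_map_not (f : Bool) (y : List Bool) :
    fundSol lam f (y.map not) = fundSol lam (!f) y := by
  induction y generalizing f with
  | nil => simp [fundSol]
  | cons b y ih => cases b <;> cases f <;> simp [fundSol, ih]

theorem chebU_ne_zero_of_le {n r : ℕ} (hU : ∀ r, 1 ≤ r → r ≤ n → chebU r lam ≠ 0) (hr : r ≤ n) :
    chebU r lam ≠ 0 := by
  rcases Nat.eq_zero_or_pos r with rfl | h
  · simp [chebU_zero]
  · exact hU r h hr

/-- The solutions of the boundary problem with one-sided inflow. -/
theorem sol_single_iff (k : ℕ) (hU : ∀ r, 1 ≤ r → r ≤ k → chebU r lam ≠ 0) (f : Bool)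
    (h : List Bool → ℂ) (a : ℂ) :
    Sol lam k h (Pi.single f a) ↔
      (∀ y : List Bool, y.length = k → h y = h (List.replicate k f) * fundSol lam f y) ∧
        a * chebU k lam = h (List.replicate k f) * chebU (k + 1) lam := by
  induction k generalizing f h a with
  | zero =>
    have : (Pi.single f a : Bool → ℂ) false + (Pi.single f a : Bool → ℂ) true = a := by
      cases f <;> simp
    simp only [Sol, this, List.length_eq_zero_iff, forall_eq, List.replicate_zero, fundSol,
      chebU_zero, chebU_one, mul_one, true_and, zero_add]
    rw [mul_comm (h [])]
  | succ k ih =>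
    have hU' : ∀ r, 1 ≤ r → r ≤ k → chebU r lam ≠ 0 := fun r h1 h2 => hU r h1 (by omega)
    have hk : chebU k lam ≠ 0 := chebU_ne_zero_of_le hU (by omega)
    have hk1 : chebU (k + 1) lam ≠ 0 := hU _ (by omega) le_rfl
    have hsq := chebU_succ_sq k lam
    have hb : ∀ P : Bool → Prop, (∀ b, P b) ↔ P f ∧ P (!f) := by
      intro P; cases f <;> simp [and_comm]
    simp only [Sol]
    rw [hb, ih hU', ih hU']
    simp only [Pi.single_eq_same, Bool.not_not, ← List.replicate_succ]
    rw [Pi.single_eq_of_ne (by simp), zero_add]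
    set X := h (List.replicate (k + 1) f) with hX
    set Y := h (List.replicate (k + 1) (!f)) with hY
    constructor
    · rintro ⟨⟨h1, h2⟩, h3, h4⟩
      have e1 := h1 (List.replicate k (!f)) (by simp)
      have e2 := h3 (List.replicate k f) (by simp)
      rw [fundSol_replicate_not] at e1
      have e3 : fundSol lam (!f) (List.replicate k f) = (chebU k lam)⁻¹ := by
        simpa using fundSol_replicate_not (lam := lam) (!f) k
      rw [e3] at e2
      rw [e1] at h4
      rw [e2] at h2
      have hXY : X = Y * chebU (k + 1) lam := by
        rw [← h4]; field_simp
      refine ⟨fun y hy => ?_, ?_⟩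
      · match y, hy with
        | b :: y, hy =>
          have hy' : y.length = k := by simpa using hy
          by_cases hbf : b = f
          · subst hbf
            rw [fundSol_cons_self, h1 y hy']
          · obtain rfl : b = !f := by cases b <;> cases f <;> simp_all
            rw [fundSol_cons_not, h3 y hy', hy', hXY]
            field_simp
      · have h2' : a * chebU k lam + Y = X * chebU (k + 1) lam := by
          rw [← h2]; field_simp
        -- Eliminating `Y` yields the claim multiplied by `U_k`; the Cassini identity brings in
        -- `U_{k+2}`.
        have : chebU k lam * (a * chebU (k + 1) lam - X * chebU (k + 2) lam) = 0 := by
          linear_combination chebU (k + 1) lam * h2' + X * hsq + hXY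
        exact sub_eq_zero.1 ((mul_eq_zero.1 this).resolve_left hk)
    · rintro ⟨h1, h2⟩
      have hf : ∀ y : List Bool, y.length = k → h (f :: y) = X * fundSol lam f y := by
        intro y hy
        rw [h1 _ (by simp [hy]), fundSol_cons_self]
      have hn : ∀ y : List Bool, y.length = k →
          h ((!f) :: y) = X / chebU (k + 1) lam * fundSol lam (!f) y := by
        intro y hy
        rw [h1 _ (by simp [hy]), fundSol_cons_not, hy]
        ring
      have hYX : Y = X / chebU (k + 1) lam := by
        rw [hY, List.replicate_succ, hn _ (by simp), fundSol_replicate, mul_one]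
      have e3 : fundSol lam (!f) (List.replicate k f) = (chebU k lam)⁻¹ := by
        simpa using fundSol_replicate_not (lam := lam) (!f) k
      refine ⟨⟨hf, ?_⟩, ?_, ?_⟩
      · rw [hn _ (by simp), e3]
        field_simp
        linear_combination chebU k lam * h2 - X * hsq
      · intro y hy
        rw [hn y hy, hYX]
      · rw [hf _ (by simp), fundSol_replicate_not, hYX]
        field_simp

end FundamentalSolution

/-! ### Block forms and the product formula -/

section BlockForms

variable {lam : ℂ}

theorem blockString_congr {j j' : ℕ → ℕ} {n : ℕ} (h : ∀ i, 1 ≤ i → i ≤ n → j i = j' i) :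
    blockString j n = blockString j' n := by
  induction n with
  | zero => rfl
  | succ n ih =>
    simp only [blockString]
    rw [h (n + 1) (by omega) le_rfl, ih fun i h1 h2 => h i h1 (by omega)]

theorem partialSum_succ (j : ℕ → ℕ) (n : ℕ) :
    partialSum j (n + 1) = j (n + 1) + partialSum j n := by
  rw [partialSum, Finset.sum_Icc_succ_top (by omega), add_comm]
  rfl

theorem length_blockString (j : ℕ → ℕ) (n : ℕ) : (blockString j n).length = partialSum j n := by
  induction n with
  | zero => simp [blockString, partialSum]
  | succ n ih => simp [blockString, partialSum_succ, ih]

theorem blockString_even_succ {j : ℕ → ℕ} {n : ℕ} (hn : Odd n) :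
    blockString j (n + 1) = List.replicate (j (n + 1)) false ++ blockString j n := by
  simp [blockString, hn.add_one]

theorem blockString_odd_succ {j : ℕ → ℕ} {n : ℕ} (hn : Even n) :
    blockString j (n + 1) = List.replicate (j (n + 1)) true ++ blockString j n := by
  simp [blockString, hn.add_one]

/-- Read from the left, `fundSol` divides exactly when a new block starts, by `U` at the length of
the suffix beginning there, and the suffix starting with block `i` has length `s_i`. An empty block
`1` contributes `U_0 = 1`. -/
theorem fundSol_blockString_mul_prod (j : ℕ → ℕ) {k : ℕ} (hk : Odd k)
    (hj : ∀ i, 2 ≤ i → i ≤ k → 1 ≤ j i)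
    (hU : ∀ r, 1 ≤ r → r ≤ partialSum j k → chebU r lam ≠ 0) :
    fundSol lam false (blockString j k) *
      ∏ i ∈ Finset.Icc 1 k, chebU (partialSum j i) lam = 1 := by
  obtain ⟨m, rfl⟩ := hk
  induction m with
  | zero =>
    have hp : partialSum j 1 = j 1 := by simp [partialSum]
    have : blockString j 1 = List.replicate (j 1) (!false) := by simp [blockString]
    simp only [mul_zero, zero_add, Finset.Icc_self, Finset.prod_singleton] at hU ⊢
    rw [this, fundSol_replicate_not, hp]
    exact inv_mul_cancel₀ (chebU_ne_zero_of_le hU hp.ge)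
  | succ m ih =>
    -- As `k` stays odd, the induction step prepends a block of `0`s and then a block of `1`s, both
    -- nonempty.
    have e : 2 * (m + 1) + 1 = 2 * m + 1 + 1 + 1 := by ring
    rw [e] at hj hU ⊢
    have hs2 := partialSum_succ j (2 * m + 1 + 1)
    have hs1 := partialSum_succ j (2 * m + 1)
    have ih' := ih (fun i h1 h2 => hj i h1 (by omega))
      fun r h1 h2 => hU r h1 (by omega)
    rw [Finset.prod_Icc_succ_top (by omega), Finset.prod_Icc_succ_top (by omega),
      blockString_odd_succ (by use m + 1; ring)]
    have hne1 : chebU (partialSum j (2 * m + 1 + 1)) lam ≠ 0 :=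
      chebU_ne_zero_of_le hU (by omega)
    have hne2 : chebU (partialSum j (2 * m + 1 + 1 + 1)) lam ≠ 0 :=
      chebU_ne_zero_of_le hU le_rfl
    obtain ⟨a, ha⟩ : ∃ a, j (2 * m + 1 + 1 + 1) = a + 1 :=
      ⟨_, (Nat.sub_add_cancel (hj _ (by omega) le_rfl)).symm⟩
    obtain ⟨b, hb⟩ : ∃ b, j (2 * m + 1 + 1) = b + 1 :=
      ⟨_, (Nat.sub_add_cancel (hj _ (by omega) (by omega))).symm⟩
    have hlen := length_blockString j (2 * m + 1)
    have key : fundSol lam false (List.replicate (j (2 * m + 1 + 1 + 1)) true ++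
        blockString j (2 * m + 1 + 1)) = fundSol lam false (blockString j (2 * m + 1)) /
          chebU (partialSum j (2 * m + 1 + 1)) lam /
          chebU (partialSum j (2 * m + 1 + 1 + 1)) lam := by
      rw [ha, List.replicate_succ, List.cons_append]
      have h1 := fundSol_cons_not (lam := lam) false
        (List.replicate a true ++ blockString j (2 * m + 1 + 1))
      have h2 := fundSol_replicate_append (lam := lam) true a (blockString j (2 * m + 1 + 1))
      rw [Bool.not_false, h2, blockString_even_succ ⟨m, rfl⟩, hb, List.replicate_succ,
        List.cons_append] at h1
      have h3 := fundSol_cons_not (lam := lam) true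
        (List.replicate b false ++ blockString j (2 * m + 1))
      rw [Bool.not_true, fundSol_replicate_append] at h3
      rw [blockString_even_succ ⟨m, rfl⟩, hb, List.replicate_succ, List.cons_append, h1, h3]
      congr 2
      · congr 1
        simp [hlen]; omega
      · simp [hlen]; omega
    rw [key, ← ih']
    field_simp

theorem fundSol_mul_prod {p : List Bool} {k : ℕ} {j : ℕ → ℕ} (h : IsBlockForm p k j)
    (hU : ∀ r, 1 ≤ r → r ≤ partialSum j k → chebU r lam ≠ 0) :
    fundSol lam false p * ∏ i ∈ Finset.Icc 1 k, chebU (partialSum j i) lam = 1 := by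
  obtain ⟨hk, hj, rfl⟩ := h
  rw [blockString_even_succ hk, fundSol_replicate_append]
  exact fundSol_blockString_mul_prod j hk hj hU

theorem IsBlockForm.length_eq {p : List Bool} {k : ℕ} {j : ℕ → ℕ} (h : IsBlockForm p k j) :
    p.length = j (k + 1) + partialSum j k := by
  rw [h.2.2, length_blockString, partialSum_succ]

theorem IsBlockForm.cons_false {p : List Bool} {k : ℕ} {j : ℕ → ℕ} (h : IsBlockForm p k j) :
    IsBlockForm (false :: p) k (Function.update j (k + 1) (j (k + 1) + 1)) := by
  obtain ⟨hk, hj, rfl⟩ := h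
  refine ⟨hk, fun i h1 h2 => ?_, ?_⟩
  · rw [Function.update_of_ne (by omega)]
    exact hj i h1 h2
  · rw [blockString_even_succ hk, blockString_even_succ hk, Function.update_self,
      List.replicate_succ, List.cons_append]
    congr 2
    exact blockString_congr fun i _ _ => (Function.update_of_ne (by omega) _ _).symm

theorem exists_isBlockForm (p : List Bool) : ∃ k j, IsBlockForm p k j := by
  induction p with
  | nil =>
    exact ⟨1, fun _ => 0, odd_one, fun i h1 h2 => by omega, by simp [blockString]⟩
  | cons b p ih =>
    obtain ⟨k, j, h⟩ := ih
    cases b with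
    | false => exact ⟨_, _, h.cons_false⟩
    | true =>
      obtain ⟨hk, hj, rfl⟩ := h
      -- If the leading block of `0`s is empty, the new `1` lengthens block `k`. Otherwise it opens
      -- block `k + 2`, under an empty block `k + 3` of `0`s.
      rcases Nat.eq_zero_or_pos (j (k + 1)) with h0 | hpos
      · obtain ⟨m, rfl⟩ := hk
        refine ⟨2 * m + 1, Function.update j (2 * m + 1) (j (2 * m + 1) + 1), ⟨m, rfl⟩,
          fun i h1 h2 => ?_, ?_⟩
        · by_cases hi : i = 2 * m + 1
          · subst hi; simp
          · rw [Function.update_of_ne hi]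
            exact hj i h1 h2
        · rw [blockString_even_succ ⟨m, rfl⟩, blockString_even_succ ⟨m, rfl⟩,
            Function.update_of_ne (by omega), h0, List.replicate_zero, List.nil_append,
            List.nil_append, blockString_odd_succ (by simp), blockString_odd_succ (by simp),
            Function.update_self, List.replicate_succ, List.cons_append]
          congr 2
          exact blockString_congr fun i _ _ => (Function.update_of_ne (by omega) _ _).symm
      · refine ⟨k + 1 + 1, Function.update (Function.update j (k + 1 + 1) 1) (k + 1 + 1 + 1) 0, ?_,
          fun i h1 h2 => ?_, ?_⟩
        · exact hk.add_even even_two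
        · rw [Function.update_of_ne (by omega)]
          by_cases hi : i = k + 2
          · subst hi; simp
          · rw [Function.update_of_ne hi]
            rcases Nat.lt_or_ge k i with hki | hki
            · obtain rfl : i = k + 1 := by omega
              exact hpos
            · exact hj i h1 hki
        · rw [blockString_even_succ (n := k + 1 + 1) (hk.add_even even_two), Function.update_self,
            blockString_odd_succ hk.add_one, Function.update_of_ne (by omega),
            Function.update_self]
          simp only [List.replicate_zero, List.nil_append, List.replicate_one, List.cons_append]
          congr 1
          refine blockString_congr fun i _ _ => ?_
          rw [Function.update_of_ne (by omega), Function.update_of_ne (by omega)]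

end BlockForms

/-! ### Gluing two one-sided solutions: first roots of `U_N` and the eigenvalue `1` -/

section TwoSided

variable {lam ε : ℂ} {n : ℕ}

theorem const_eq_cons (b : Bool) : (fun _ => b : Word (n + 1)) = Fin.cons b fun _ => b := by
  funext i
  exact Fin.cases rfl (fun _ => rfl) i

theorem forall_length_iff {P : List Bool → Prop} :
    (∀ y : List Bool, y.length = n → P y) ↔ ∀ y : Word n, P (List.ofFn y) := by
  refine ⟨fun h y => h _ (by simp), fun h y hy => ?_⟩
  obtain ⟨x, rfl⟩ := exists_ofFn_eq hy
  exact h x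

theorem listExt_cons (c : Word (n + 1) → ℂ) (b : Bool) (y : Word n) :
    listExt c (b :: List.ofFn y) = c (Fin.cons b y) := by
  rw [← listExt_ofFn c, List.ofFn_cons]

/-- Copy `b` has inflow `c(b bⁿ) + c((!b) bⁿ)`, from the loop and from the other copy, and the
second term is the value at the other constant string divided by `U_n`. Inserting this into `a U_n =
X U_{n+1}` gives the last condition. -/
theorem mem_eigenspace_halfA'_succ (hU : ∀ r, 1 ≤ r → r ≤ n → chebU r lam ≠ 0)
    {c : Word (n + 1) → ℂ} :
    c ∈ (halfA' (n + 1)).eigenspace lam ↔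
      ∀ b, (∀ y : Word n, c (Fin.cons b y) = c (fun _ => b) * fundSol lam b (List.ofFn y)) ∧
        c (fun _ => !b) = (chebU (n + 1) lam - chebU n lam) * c fun _ => b := by
  have hn : chebU n lam ≠ 0 := chebU_ne_zero_of_le hU le_rfl
  rw [mem_eigenspace_halfA' (by omega)]
  simp only [Sol, sol_single_iff n hU, forall_length_iff, ← List.ofFn_const, listExt_cons]
  simp only [← const_eq_cons, forall_and]
  refine and_congr_right fun h => forall_congr' fun b => ?_
  have hb := h (!b) fun _ => b
  have h1 := fundSol_replicate_not (lam := lam) (!b) n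
  rw [Bool.not_not] at h1
  rw [List.ofFn_const, h1] at hb
  rw [hb]
  constructor <;> intro H
  · field_simp at H
    linear_combination H
  · rw [H]
    field_simp
    ring

/-- The eigenvector of `½ A'` with components given by the fundamental solution at the strings
beginning with `0`, and multiplied by `ε` under complementation. -/
noncomputable def twoSidedSol (lam ε : ℂ) (x : Word (n + 1)) : ℂ :=
  (if x 0 then ε else 1) * fundSol lam (x 0) (List.ofFn (Fin.tail x))

theorem twoSidedSol_cons (b : Bool) (y : Word n) :
    twoSidedSol lam ε (Fin.cons b y : Word (n + 1)) =
      (if b then ε else 1) * fundSol lam b (List.ofFn y) := rfl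

theorem twoSidedSol_const (b : Bool) :
    twoSidedSol lam ε (fun _ => b : Word (n + 1)) = if b then ε else 1 := by
  rw [const_eq_cons, twoSidedSol_cons, List.ofFn_const, fundSol_replicate, mul_one]

theorem bitFlip_cons (b : Bool) (y : Word n) :
    bitFlip (Fin.cons b y : Word (n + 1)) = Fin.cons (!b) (bitFlip y) := by
  funext i
  exact Fin.cases rfl (fun _ => rfl) i

theorem ofFn_bitFlip (y : Word n) : List.ofFn (bitFlip y) = (List.ofFn y).map not := by
  rw [List.map_ofFn]
  rfl

theorem twoSidedSol_bitFlip (hε : ε ^ 2 = 1) (x : Word (n + 1)) :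
    twoSidedSol lam ε (bitFlip x) = ε * twoSidedSol lam ε x := by
  obtain ⟨b, y, rfl⟩ : ∃ b y, x = Fin.cons b y := ⟨x 0, Fin.tail x, (Fin.cons_self_tail x).symm⟩
  rw [bitFlip_cons, twoSidedSol_cons, twoSidedSol_cons, ofFn_bitFlip, fundSol_map_not,
    Bool.not_not, ← mul_assoc]
  congr 1
  cases b <;> simp [← sq, hε]

/-- The two gluing conditions say that each constant component is `ε` times the other; `ε² = 1`
makes them equivalent, leaving one free parameter. -/
theorem twoSidedSol_spec (hU : ∀ r, 1 ≤ r → r ≤ n → chebU r lam ≠ 0)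
    (hε : chebU (n + 1) lam - chebU n lam = ε) (hε2 : ε ^ 2 = 1) :
    (halfA' (n + 1)).HasEigenvector lam (twoSidedSol lam ε) ∧
      (halfA' (n + 1)).eigenspace lam = Submodule.span ℂ {twoSidedSol lam ε} := by
  have hmem : twoSidedSol lam ε ∈ (halfA' (n + 1)).eigenspace lam := by
    rw [mem_eigenspace_halfA'_succ hU, hε]
    intro b
    simp only [twoSidedSol_const]
    refine ⟨fun y => twoSidedSol_cons b y, ?_⟩
    cases b <;> simp [← sq, hε2]
  refine ⟨⟨hmem, fun h => ?_⟩, le_antisymm (fun c hc => ?_) ?_⟩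
  · have := congrFun h fun _ => false
    rw [twoSidedSol_const] at this
    simp at this
  · rw [mem_eigenspace_halfA'_succ hU, hε] at hc
    rw [Submodule.mem_span_singleton]
    refine ⟨c fun _ => false, funext fun x => ?_⟩
    obtain ⟨b, y, rfl⟩ : ∃ b y, x = Fin.cons b y := ⟨x 0, Fin.tail x, (Fin.cons_self_tail x).symm⟩
    rw [(hc b).1, Pi.smul_apply, twoSidedSol_cons, smul_eq_mul]
    cases b with
    | false => simp
    | true =>
      have := (hc false).2
      rw [Bool.not_false] at this
      rw [this, if_pos rfl]
      ring
  · rw [Submodule.span_singleton_le_iff_mem]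
    exact hmem

theorem eq_twoSidedSol_iff (hU : ∀ r, 1 ≤ r → r ≤ n → chebU r lam ≠ 0) (hε2 : ε ^ 2 = 1)
    (c : Word (n + 1) → ℂ) :
    c = twoSidedSol lam ε ↔
      (∀ (x : Word (n + 1)) (k : ℕ) (j : ℕ → ℕ), IsBlockForm (List.ofFn x) k j → 1 ≤ j (k + 1) →
        c x * ∏ i ∈ Finset.Icc 1 k, chebU (partialSum j i) lam = 1) ∧
      ∀ x, c (bitFlip x) = ε * c x := by
  constructor
  · rintro rfl
    refine ⟨fun x k j h hj => ?_, twoSidedSol_bitFlip hε2⟩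
    have hlen := h.length_eq
    rw [List.length_ofFn] at hlen
    -- Since `j_{k+1} ≥ 1`, every `s_i` is at most `n`, so the possibly vanishing `U_{n+1}` does not
    -- occur.
    have hprod := fundSol_mul_prod (lam := lam) h fun r h1 h2 => hU r h1 (by omega)
    obtain ⟨b, y, rfl⟩ : ∃ b y, x = Fin.cons b y := ⟨x 0, Fin.tail x, (Fin.cons_self_tail x).symm⟩
    have hb : b = false := by
      obtain ⟨a, ha⟩ : ∃ a, j (k + 1) = a + 1 := ⟨_, (Nat.sub_add_cancel hj).symm⟩
      have := h.2.2
      rw [blockString_even_succ h.1, ha, List.replicate_succ, List.cons_append,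
        List.ofFn_cons] at this
      exact (List.cons.inj this).1
    subst hb
    rw [List.ofFn_cons, fundSol_cons_self] at hprod
    rw [twoSidedSol_cons, if_neg (by simp), one_mul, hprod]
  · rintro ⟨h1, h2⟩
    have h0 : ∀ y : Word n, c (Fin.cons false y) = fundSol lam false (List.ofFn y) := by
      intro y
      obtain ⟨k, j, h⟩ := exists_isBlockForm (List.ofFn y)
      -- Prepending `0` only lengthens block `k + 1`, so the product formula applies to `0y`; its
      -- product is nonzero and determines the component.
      have hf := h.cons_false
      have hlen := hf.length_eq
      rw [List.length_cons, List.length_ofFn, Function.update_self] at hlen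
      have e1 := h1 (Fin.cons false y) _ _ (by rw [List.ofFn_cons]; exact hf) (by simp)
      have e2 := fundSol_mul_prod (lam := lam) hf fun r h1 h2 => hU r h1 (by omega)
      rw [fundSol_cons_self] at e2
      exact mul_right_cancel₀ (right_ne_zero_of_mul_eq_one e2) (e1.trans e2.symm)
    funext x
    obtain ⟨b, y, rfl⟩ : ∃ b y, x = Fin.cons b y := ⟨x 0, Fin.tail x, (Fin.cons_self_tail x).symm⟩
    rw [twoSidedSol_cons]
    cases b with
    | false => rw [h0]; simp
    | true =>
      have hx : (Fin.cons true y : Word (n + 1)) = bitFlip (Fin.cons false (bitFlip y)) := by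
        rw [bitFlip_cons]
        congr 1
        funext i
        simp [bitFlip]
      rw [hx, h2, h0, ofFn_bitFlip, fundSol_map_not]
      simp

theorem neg_chebU_sq_of_root (hroot : chebU (n + 1) lam = 0) : (-chebU n lam) ^ 2 = 1 := by
  cases n with
  | zero => simp [chebU_zero]
  | succ m =>
    rw [neg_sq, chebU_succ_sq, hroot]
    ring

theorem isTopVector_iff (hroot : chebU (n + 1) lam = 0)
    (hU : ∀ r, 1 ≤ r → r ≤ n → chebU r lam ≠ 0) (c : Word (n + 1) → ℂ) :
    IsTopVector (n + 1) lam c ↔ c = twoSidedSol lam (-chebU n lam) := by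
  have hsq := neg_chebU_sq_of_root hroot
  constructor
  · intro h
    exact (eq_twoSidedSol_iff hU hsq c).2 ⟨h.rel_jj, h.rel_flip⟩
  · intro h
    obtain ⟨h1, h2⟩ := (eq_twoSidedSol_iff hU hsq c).1 h
    refine ⟨?_, h1, h2⟩
    rw [h, twoSidedSol_const]
    simp

theorem isStationaryVector_iff (c : Word (n + 1) → ℂ) :
    IsStationaryVector (n + 1) c ↔ c = twoSidedSol 1 1 := by
  have hU : ∀ r, 1 ≤ r → r ≤ n → chebU r 1 ≠ 0 := by
    intro r _ _
    rw [chebU_at_one]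
    exact Nat.cast_add_one_ne_zero r
  rw [eq_twoSidedSol_iff hU (by norm_num)]
  simp only [chebU_at_one, one_mul, add_comm _ (1 : ℂ)]
  exact ⟨fun h => ⟨h.rel_prod, h.rel_flip⟩, fun h => ⟨h.1, h.2⟩⟩

end TwoSided

/-! ### Decoupling at a first root of `U_{ℓ+1}` -/

section Prefix

variable {lam : ℂ} {ℓ : ℕ}

/-- The common eigenvector of `½ A` and `½ A'` for strings of length `ℓ + 2`, where `lam` is a root
of `U_{ℓ+1}`, normalised at `100…0`. -/
noncomputable def baseSol (lam : ℂ) : List Bool → ℂ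
  | true :: false :: p => fundSol lam false p
  | false :: true :: p => -chebU p.length lam * fundSol lam true p
  | _ => 0

theorem baseSol_replicate (b : Bool) : baseSol lam (List.replicate (ℓ + 2) b) = 0 := by
  cases b <;> rfl

theorem baseSol_self : baseSol lam (true :: false :: List.replicate ℓ false) = 1 :=
  fundSol_replicate false ℓ

theorem sol_single_iff_of_root (hroot : chebU (ℓ + 1) lam = 0)
    (hU : ∀ r, 1 ≤ r → r ≤ ℓ → chebU r lam ≠ 0) (f : Bool) (h : List Bool → ℂ) (a : ℂ) :
    Sol lam ℓ h (Pi.single f a) ↔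
      (∀ y : List Bool, y.length = ℓ → h y = h (List.replicate ℓ f) * fundSol lam f y) ∧
        a = 0 := by
  have hℓ : chebU ℓ lam ≠ 0 := chebU_ne_zero_of_le hU le_rfl
  rw [sol_single_iff ℓ hU, hroot, mul_zero, mul_eq_zero, or_iff_left hℓ]

theorem inv_chebU_of_root (hroot : chebU (ℓ + 1) lam = 0) :
    (chebU ℓ lam)⁻¹ = chebU ℓ lam := by
  have h := neg_chebU_sq_of_root hroot
  exact inv_eq_of_mul_eq_one_left (by linear_combination h)

/-- Two splittings lead to four one-sided problems of length `ℓ`, in each of which the inflow must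
vanish. The inflow into `b(!b)` comes only from `bb` and is the entry value of `bb` divided by
`U_ℓ`, so the solution on `bb` is zero. The balance at the entry of `bb` is the last condition;
there `1 / U_ℓ = U_ℓ`. -/
theorem sol_add_two_iff (hroot : chebU (ℓ + 1) lam = 0)
    (hU : ∀ r, 1 ≤ r → r ≤ ℓ → chebU r lam ≠ 0) (h : List Bool → ℂ) (α : Bool → ℂ) :
    Sol lam (ℓ + 2) h α ↔
      (∀ b, ∀ y : List Bool, y.length = ℓ → h (b :: b :: y) = 0) ∧
      (∀ b, ∀ y : List Bool, y.length = ℓ →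
        h (b :: (!b) :: y) = h (b :: (!b) :: List.replicate ℓ (!b)) * fundSol lam (!b) y) ∧
      ∀ b, α b + h ((!b) :: b :: List.replicate ℓ b) +
        h (b :: (!b) :: List.replicate ℓ (!b)) * chebU ℓ lam = 0 := by
  have hℓ : chebU ℓ lam ≠ 0 := chebU_ne_zero_of_le hU le_rfl
  have hb : ∀ (b : Bool) (P : Bool → Prop), (∀ d, P d) ↔ P b ∧ P (!b) := by
    intro b P; cases b <;> simp [and_comm]
  have hrep : ∀ b, fundSol lam (!b) (List.replicate ℓ b) = chebU ℓ lam := by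
    intro b
    have := fundSol_replicate_not (lam := lam) (!b) ℓ
    rwa [Bool.not_not, inv_chebU_of_root hroot] at this
  have hexp : Sol lam (ℓ + 2) h α ↔ ∀ b,
      ((∀ y : List Bool, y.length = ℓ →
          h (b :: b :: y) = h (b :: b :: List.replicate ℓ b) * fundSol lam b y) ∧
        α b + h ((!b) :: b :: List.replicate ℓ b) + h (b :: (!b) :: List.replicate ℓ b) = 0) ∧
      (∀ y : List Bool, y.length = ℓ →
          h (b :: (!b) :: y) = h (b :: (!b) :: List.replicate ℓ (!b)) * fundSol lam (!b) y) ∧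
        h (b :: b :: List.replicate ℓ (!b)) = 0 := by
    refine forall_congr' fun b => ?_
    simp only [Sol]
    rw [hb b]
    simp only [sol_single_iff_of_root hroot hU]
    rw [Pi.single_eq_same, Pi.single_eq_of_ne (by simp), zero_add, Bool.not_not,
      List.replicate_succ]
  rw [hexp, ← forall_and, ← forall_and]
  refine forall_congr' fun b => ?_
  constructor
  · rintro ⟨⟨h1, h2⟩, h3, h4⟩
    have hX : h (b :: b :: List.replicate ℓ b) = 0 := by
      rw [h1 _ (by simp), fundSol_replicate_not] at h4
      exact (mul_eq_zero.1 h4).resolve_right (inv_ne_zero hℓ)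
    refine ⟨fun y hy => by rw [h1 y hy, hX, zero_mul], h3, ?_⟩
    rw [h3 _ (by simp), hrep] at h2
    exact h2
  · rintro ⟨h1, h3, h2⟩
    refine ⟨⟨fun y hy => by rw [h1 y hy, h1 _ (by simp), zero_mul], ?_⟩, h3, h1 _ (by simp)⟩
    rw [h3 _ (by simp), hrep]
    exact h2

/-- After each prefix of length `r`, the function is a multiple of `baseSol` on the strings of
length `ℓ + 2`. -/
def IsPrefixCombination (lam : ℂ) (r ℓ : ℕ) (h : List Bool → ℂ) : Prop :=
  ∀ q p : List Bool, q.length = r → p.length = ℓ + 2 →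
    h (q ++ p) = h (q ++ true :: false :: List.replicate ℓ false) * baseSol lam p

theorem IsPrefixCombination.apply_replicate {r : ℕ} {h : List Bool → ℂ}
    (H : IsPrefixCombination lam r ℓ h) (b : Bool) :
    h (List.replicate (r + (ℓ + 2)) b) = 0 := by
  rw [List.replicate_add, H _ _ (by simp) (by simp), baseSol_replicate, mul_zero]

theorem isPrefixCombination_succ {r : ℕ} {h : List Bool → ℂ} :
    IsPrefixCombination lam (r + 1) ℓ h ↔
      ∀ b, IsPrefixCombination lam r ℓ fun y => h (b :: y) := by
  constructor
  · intro H b q p hq hp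
    exact H (b :: q) p (by simp [hq]) hp
  · intro H q p hq hp
    match q, hq with
    | b :: q, hq => exact H b q p (by simpa using hq) hp

theorem isPrefixCombination_zero {h : List Bool → ℂ} :
    IsPrefixCombination lam 0 ℓ h ↔
      (∀ b, ∀ y : List Bool, y.length = ℓ → h (b :: b :: y) = 0) ∧
      (∀ y : List Bool, y.length = ℓ → h (true :: false :: y) =
        h (true :: false :: List.replicate ℓ false) * fundSol lam false y) ∧
      (∀ y : List Bool, y.length = ℓ → h (false :: true :: y) =
        h (true :: false :: List.replicate ℓ false) * (-chebU ℓ lam * fundSol lam true y)) := by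
  constructor
  · intro H
    refine ⟨fun b y hy => ?_, fun y hy => H [] _ rfl (by simp [hy]), fun y hy => ?_⟩
    · have := H [] (b :: b :: y) rfl (by simp [hy])
      cases b <;> simpa [baseSol] using this
    · have := H [] (false :: true :: y) rfl (by simp [hy])
      simpa [baseSol, hy] using this
  · rintro ⟨h1, h2, h3⟩ q p hq hp
    obtain rfl := List.length_eq_zero_iff.1 hq
    match p, hp with
    | b :: d :: y, hp =>
      have hy : y.length = ℓ := by simpa using hp
      cases b <;> cases d <;> simp [baseSol, h1 _ y hy, h2 y hy, h3 y hy, hy]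

/-- The admitted inflows are those needed: one-sided ones, which include zero and arise under
splitting, and those of the self-loops. All turn out to be zero. -/
theorem sol_iff_isPrefixCombination (hroot : chebU (ℓ + 1) lam = 0)
    (hU : ∀ r, 1 ≤ r → r ≤ ℓ → chebU r lam ≠ 0) (r : ℕ) (h : List Bool → ℂ) (α : Bool → ℂ)
    (hα : (∃ b a, α = Pi.single b a) ∨ α = fun b => h (List.replicate (r + (ℓ + 2)) b)) :
    Sol lam (r + (ℓ + 2)) h α ↔ α = 0 ∧ IsPrefixCombination lam r ℓ h := by
  induction r generalizing h α with
  | zero =>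
    have hsq := neg_chebU_sq_of_root hroot
    rw [zero_add, sol_add_two_iff hroot hU, isPrefixCombination_zero]
    simp only [Bool.forall_bool (p := fun b => _ + _ + _ = _), Bool.not_false, Bool.not_true]
    constructor
    · rintro ⟨h1, h2, h3, h4⟩
      -- For one-sided inflow, the two balances have the same homogeneous part up to the factor
      -- `U_ℓ`, because `U_ℓ² = 1`; a suitable combination leaves `a = 0`. Loop inflows are
      -- components at constant strings, already known to vanish.
      have hα0 : α = 0 := by
        rcases hα with ⟨b, a, rfl⟩ | rfl
        · have : a = 0 := by
            cases b
            · simp at h3 h4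
              linear_combination h3 - chebU ℓ lam * h4 +
                h (true :: false :: List.replicate ℓ false) * hsq
            · simp at h3 h4
              linear_combination h4 - chebU ℓ lam * h3 +
                h (false :: true :: List.replicate ℓ true) * hsq
          simp [this]
        · funext b
          simp only [zero_add]
          exact h1 b _ (by simp)
      subst hα0
      refine ⟨rfl, h1, h2 true, fun y hy => ?_⟩
      have h5 := h2 false y hy
      simp only [Bool.not_false] at h5
      simp only [Pi.zero_apply, zero_add] at h4
      rw [h5]
      linear_combination fundSol lam true y * h4
    · rintro ⟨rfl, h1, h2, h3⟩
      have h4 := h3 (List.replicate ℓ true) (by simp)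
      rw [fundSol_replicate, mul_one] at h4
      refine ⟨h1, fun b y hy => ?_, ?_, ?_⟩
      · cases b
        · simp only [Bool.not_false]
          rw [h3 y hy, h4]
          ring
        · exact h2 y hy
      · rw [h4, Pi.zero_apply]
        linear_combination -h (true :: false :: List.replicate ℓ false) * hsq
      · rw [h4, Pi.zero_apply]
        ring
  | succ r ih =>
    have e : r + 1 + (ℓ + 2) = r + (ℓ + 2) + 1 := by ring
    rw [e, isPrefixCombination_succ]
    rw [sol_succ, forall_congr' fun b => ih _ _ (Or.inl ⟨b, _, rfl⟩), forall_and]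
    refine and_congr_left fun H => ?_
    rw [funext_iff]
    refine forall_congr' fun b => ?_
    -- The joining edge starts at a constant tail in the other copy, where a prefix combination
    -- vanishes.
    have := (H (!b)).apply_replicate b
    rw [this, add_zero, Pi.single_eq_zero_iff, Pi.zero_apply]

end Prefix

/-! ### The basis indexed by prefixes -/

section PrefixBasis

variable {lam : ℂ} {N ℓ : ℕ}

/-- The vector supported on the strings beginning with `q`, given by `baseSol` on the remaining
symbols. -/
noncomputable def prefixVec (lam : ℂ) {r : ℕ} (q : Word r) (x : Word N) : ℂ :=
  if (List.ofFn x).take r = List.ofFn q then baseSol lam ((List.ofFn x).drop r) else 0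

theorem prefixVec_of_append {r : ℕ} {q : Word r} {x : Word N} {q' p : List Bool}
    (hq' : q'.length = r) (hx : List.ofFn x = q' ++ p) :
    prefixVec lam q x = if q' = List.ofFn q then baseSol lam p else 0 := by
  rw [prefixVec, hx, List.take_left' hq', List.drop_left' hq']

theorem mem_eigenspace_halfA_iff_isPrefixCombination (hN : ℓ + 2 ≤ N)
    (hroot : chebU (ℓ + 1) lam = 0) (hU : ∀ r, 1 ≤ r → r ≤ ℓ → chebU r lam ≠ 0)
    {c : Word N → ℂ} :
    c ∈ (halfA N).eigenspace lam ↔ IsPrefixCombination lam (N - ℓ - 2) ℓ (listExt c) := by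
  obtain ⟨r, rfl⟩ : ∃ r, N = r + (ℓ + 2) := ⟨N - (ℓ + 2), by omega⟩
  have hr : r + (ℓ + 2) - ℓ - 2 = r := by omega
  -- Without self-loops the inflow is zero, regarded as a one-sided inflow of size `0`.
  rw [mem_eigenspace_halfA, hr, sol_iff_isPrefixCombination hroot hU _ _ _
    (Or.inl ⟨true, 0, (Pi.single_zero _).symm⟩)]
  simp

theorem mem_eigenspace_halfA'_iff_isPrefixCombination (hN : ℓ + 2 ≤ N)
    (hroot : chebU (ℓ + 1) lam = 0) (hU : ∀ r, 1 ≤ r → r ≤ ℓ → chebU r lam ≠ 0)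
    {c : Word N → ℂ} :
    c ∈ (halfA' N).eigenspace lam ↔ IsPrefixCombination lam (N - ℓ - 2) ℓ (listExt c) := by
  obtain ⟨r, rfl⟩ : ∃ r, N = r + (ℓ + 2) := ⟨N - (ℓ + 2), by omega⟩
  have hr : r + (ℓ + 2) - ℓ - 2 = r := by omega
  have hc : (fun b => c fun _ => b) =
      fun b => listExt c (List.replicate (r + (ℓ + 2)) b) := by
    funext b
    rw [← List.ofFn_const, listExt_ofFn]
  rw [mem_eigenspace_halfA' (by omega), hr, hc,
    sol_iff_isPrefixCombination hroot hU _ _ _ (Or.inr rfl)]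
  refine and_iff_right_of_imp fun H => funext fun b => ?_
  exact H.apply_replicate b

theorem length_ofFn_append (hN : ℓ + 2 ≤ N) (q : Word (N - ℓ - 2)) {p : List Bool}
    (hp : p.length = ℓ + 2) : (List.ofFn q ++ p).length = N := by
  rw [List.length_append, List.length_ofFn, hp]
  omega

/-- The string `q10…0`. -/
theorem exists_pivot (hN : ℓ + 2 ≤ N) (q : Word (N - ℓ - 2)) :
    ∃ x : Word N, List.ofFn x = List.ofFn q ++ true :: false :: List.replicate ℓ false :=
  exists_ofFn_eq (length_ofFn_append hN q (by simp))

/-- The components at the strings `q10…0` serve as coordinates: they give both spanning and linear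
independence. -/
theorem prefixVec_pivot {q q' : Word (N - ℓ - 2)} {x : Word N}
    (hx : List.ofFn x = List.ofFn q' ++ true :: false :: List.replicate ℓ false) :
    prefixVec lam q x = if q' = q then 1 else 0 := by
  rw [prefixVec_of_append (by simp) hx, baseSol_self]
  simp [List.ofFn_injective.eq_iff]

theorem isPrefixCombination_prefixVec (hN : ℓ + 2 ≤ N) (q : Word (N - ℓ - 2)) :
    IsPrefixCombination lam (N - ℓ - 2) ℓ (listExt (prefixVec lam q : Word N → ℂ)) := by
  intro q' p hq' hp
  obtain ⟨w, rfl⟩ := exists_ofFn_eq hq'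
  obtain ⟨x, hx⟩ := exists_ofFn_eq (length_ofFn_append hN w hp)
  obtain ⟨z, hz⟩ := exists_pivot hN w
  rw [← hx, ← hz, listExt_ofFn, listExt_ofFn, prefixVec_pivot hz, prefixVec_of_append hq' hx]
  simp [List.ofFn_injective.eq_iff]

theorem mem_span_prefixVec (hN : ℓ + 2 ≤ N) {c : Word N → ℂ}
    (hc : IsPrefixCombination lam (N - ℓ - 2) ℓ (listExt c)) :
    c ∈ Submodule.span ℂ
      (Set.range fun q : Word (N - ℓ - 2) => (prefixVec lam q : Word N → ℂ)) := by
  choose e he using exists_pivot (ℓ := ℓ) hN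
  have : c = ∑ q, c (e q) • (prefixVec lam q : Word N → ℂ) := by
    funext x
    obtain ⟨w, hw⟩ : ∃ w : Word (N - ℓ - 2), List.ofFn w = (List.ofFn x).take (N - ℓ - 2) :=
      exists_ofFn_eq (by simp; omega)
    have hx : List.ofFn x = List.ofFn w ++ (List.ofFn x).drop (N - ℓ - 2) := by
      rw [hw, List.take_append_drop]
    have h := hc (List.ofFn w) ((List.ofFn x).drop (N - ℓ - 2)) (by simp) (by simp; omega)
    rw [← hx, ← he, listExt_ofFn, listExt_ofFn] at h
    have hv : ∀ q, prefixVec lam q x =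
        if w = q then baseSol lam ((List.ofFn x).drop (N - ℓ - 2)) else 0 := by
      intro q
      rw [prefixVec_of_append (by simp) hx]
      simp [List.ofFn_injective.eq_iff]
    simp [Finset.sum_apply, hv, h]
  rw [this]
  exact Submodule.sum_mem _ fun q _ => Submodule.smul_mem _ _ (Submodule.subset_span ⟨q, rfl⟩)

theorem linearIndependent_prefixVec (hN : ℓ + 2 ≤ N) :
    LinearIndependent ℂ fun q : Word (N - ℓ - 2) => (prefixVec lam q : Word N → ℂ) := by
  rw [Fintype.linearIndependent_iff]
  intro g hg q
  obtain ⟨x, hx⟩ := exists_pivot hN q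
  have := congrFun hg x
  simpa [Finset.sum_apply, prefixVec_pivot hx] using this

theorem prefixVec_ne_zero (hN : ℓ + 2 ≤ N) (q : Word (N - ℓ - 2)) :
    (prefixVec lam q : Word N → ℂ) ≠ 0 := by
  intro h
  obtain ⟨x, hx⟩ := exists_pivot hN q
  have := congrFun h x
  rw [prefixVec_pivot hx] at this
  simp at this

theorem partialSum_le_length {p : List Bool} {k : ℕ} {j : ℕ → ℕ} (h : IsBlockForm p k j) :
    partialSum j k ≤ p.length := by
  have := h.length_eq
  omega

theorem isPrefixVector_prefixVec (hU : ∀ r, 1 ≤ r → r ≤ ℓ → chebU r lam ≠ 0)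
    (q : Word (N - ℓ - 2)) : IsPrefixVector N ℓ lam q (prefixVec lam q) := by
  have key : ∀ (x : Word N) (p : List Bool), List.ofFn x = List.ofFn q ++ p →
      prefixVec lam q x = baseSol lam p := by
    intro x p hx
    rw [prefixVec_of_append (by simp) hx, if_pos rfl]
  refine ⟨fun x hx => ?_, fun x p _ hx => ?_, fun x hx => ?_, fun x p k j hp hf hx => ?_,
    fun x p _ hx => ?_, fun x y p hp hx hy => ?_⟩
  · refine if_neg fun h => hx ?_
    rw [← h]
    exact List.take_prefix _ _
  · rw [List.append_assoc] at hx
    exact key x _ hx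
  · rw [List.append_assoc] at hx
    rw [key x _ hx]
    exact baseSol_self
  · rw [List.append_assoc] at hx
    rw [key x _ hx]
    refine fundSol_mul_prod hf fun r h1 h2 => hU r h1 ?_
    have := partialSum_le_length hf
    omega
  · rw [List.append_assoc] at hx
    exact key x _ hx
  · rw [List.append_assoc] at hx hy
    rw [key x _ hx, key y _ hy]
    change -chebU p.length lam * fundSol lam true p = _ * fundSol lam false (p.map not)
    rw [fundSol_map_not, hp, Bool.not_false]

/-- Every string of length `ℓ` has a block form and the product in (iii) is nonzero, so (iii) fixes
the components at `q10p`; (iv) then fixes those at `q01p`, and the remaining ones are prescribed to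
be zero. -/
theorem isPrefixVector_iff (hN : ℓ + 2 ≤ N) (hU : ∀ r, 1 ≤ r → r ≤ ℓ → chebU r lam ≠ 0)
    (q : Word (N - ℓ - 2)) (c : Word N → ℂ) :
    IsPrefixVector N ℓ lam q c ↔ c = prefixVec lam q := by
  refine ⟨fun h => funext fun x => ?_, fun h => h ▸ isPrefixVector_prefixVec hU q⟩
  have h' := isPrefixVector_prefixVec hU q
  by_cases hx : List.ofFn q <+: List.ofFn x
  swap
  · rw [h.off_prefix x hx, h'.off_prefix x hx]
  obtain ⟨p, hp⟩ := hx
  have hlen : p.length = ℓ + 2 := by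
    have := congrArg List.length hp
    simp only [List.length_append, List.length_ofFn] at this
    omega
  have h10 : ∀ (y : Word N) (p : List Bool), p.length = ℓ →
      List.ofFn y = List.ofFn q ++ [true, false] ++ p → c y = prefixVec lam q y := by
    intro y p hp hy
    obtain ⟨k, j, hf⟩ := exists_isBlockForm p
    have e1 := h.rel_iii y p k j hp hf hy
    have e2 := h'.rel_iii y p k j hp hf hy
    exact mul_right_cancel₀ (right_ne_zero_of_mul_eq_one e2) (e1.trans e2.symm)
  match p, hlen with
  | b :: d :: p, hlen =>
    have hp' : p.length = ℓ := by simpa using hlen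
    have hx : List.ofFn x = List.ofFn q ++ [b, d] ++ p := by simp [← hp]
    cases b <;> cases d
    · rw [h.rel_i x p hp' hx, h'.rel_i x p hp' hx]
    · obtain ⟨y, hy⟩ : ∃ y : Word N, List.ofFn y = List.ofFn q ++ (true :: false :: p.map not) :=
        exists_ofFn_eq (length_ofFn_append hN q (by simp [hp']))
      have hy' : List.ofFn y = List.ofFn q ++ [true, false] ++ p.map not := by simp [hy]
      rw [h.rel_iv_flip x y p hp' hx hy', h'.rel_iv_flip x y p hp' hx hy',
        h10 y _ (by simp [hp']) hy']
    · exact h10 x p hp' hx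
    · rw [h.rel_iv_zero x p hp' hx, h'.rel_iv_zero x p hp' hx]

theorem eigenspace_eq_span_prefixVec (hN : ℓ + 2 ≤ N)
    (hroot : chebU (ℓ + 1) lam = 0) (hU : ∀ r, 1 ≤ r → r ≤ ℓ → chebU r lam ≠ 0) :
    (halfA N).eigenspace lam = Submodule.span ℂ
        (Set.range fun q : Word (N - ℓ - 2) => (prefixVec lam q : Word N → ℂ)) ∧
      (halfA' N).eigenspace lam = Submodule.span ℂ
        (Set.range fun q : Word (N - ℓ - 2) => (prefixVec lam q : Word N → ℂ)) := by
  constructor <;> refine le_antisymm (fun c hc => mem_span_prefixVec hN ?_)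
    (Submodule.span_le.2 (Set.range_subset_iff.2 fun q => ?_))
  · exact (mem_eigenspace_halfA_iff_isPrefixCombination hN hroot hU).1 hc
  · exact (mem_eigenspace_halfA_iff_isPrefixCombination hN hroot hU).2
      (isPrefixCombination_prefixVec hN q)
  · exact (mem_eigenspace_halfA'_iff_isPrefixCombination hN hroot hU).1 hc
  · exact (mem_eigenspace_halfA'_iff_isPrefixCombination hN hroot hU).2
      (isPrefixCombination_prefixVec hN q)

theorem hasEigenvector_prefixVec (hN : ℓ + 2 ≤ N)
    (hroot : chebU (ℓ + 1) lam = 0) (hU : ∀ r, 1 ≤ r → r ≤ ℓ → chebU r lam ≠ 0)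
    (q : Word (N - ℓ - 2)) :
    (halfA N).HasEigenvector lam (prefixVec lam q) ∧
      (halfA' N).HasEigenvector lam (prefixVec lam q) := by
  obtain ⟨h1, h2⟩ := eigenspace_eq_span_prefixVec hN hroot hU
  exact ⟨⟨h1.ge (Submodule.subset_span ⟨q, rfl⟩), prefixVec_ne_zero hN q⟩,
    ⟨h2.ge (Submodule.subset_span ⟨q, rfl⟩), prefixVec_ne_zero hN q⟩⟩

theorem exists_minimal_root {m : ℕ} (hm : chebU m lam = 0) :
    ∃ ℓ, ℓ + 1 ≤ m ∧ chebU (ℓ + 1) lam = 0 ∧ ∀ r, 1 ≤ r → r ≤ ℓ → chebU r lam ≠ 0 := by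
  classical
  have hex : ∃ m, chebU m lam = 0 := ⟨m, hm⟩
  have h0 : Nat.find hex ≠ 0 := by
    intro h
    have := Nat.find_spec hex
    rw [h, chebU_zero] at this
    exact one_ne_zero this
  obtain ⟨ℓ, hℓ⟩ := Nat.exists_eq_succ_of_ne_zero h0
  refine ⟨ℓ, ?_, ?_, fun r _ hr => Nat.find_min hex (by omega)⟩
  · have := Nat.find_min' hex hm
    omega
  · have := Nat.find_spec hex
    rwa [hℓ] at this

end PrefixBasis

end HysteresisGraph

/-! ### The main theorem -/

open HysteresisGraph in
theorem theorem5 (N : ℕ) (hN : 1 ≤ N) :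
    -- the same eigenvectors for the roots of `U_m`, `m ≤ N - 1`
    (∀ (m : ℕ) (lam : ℂ), m ≤ N - 1 → chebU m lam = 0 →
      (halfA N).HasEigenvalue lam ∧ (halfA' N).HasEigenvalue lam ∧
      ∀ v : Word N → ℂ, (halfA N).HasEigenvector lam v ↔ (halfA' N).HasEigenvector lam v) ∧
    -- they are the eigenvectors defined by (i) -- (iv)
    (∀ (ℓ : ℕ) (lam : ℂ), ℓ + 2 ≤ N → chebU (ℓ + 1) lam = 0 →
      (∀ r, 1 ≤ r → r ≤ ℓ → chebU r lam ≠ 0) →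
      ∃ b : Word (N - ℓ - 2) → (Word N → ℂ),
        (∀ q c, IsPrefixVector N ℓ lam q c ↔ c = b q) ∧
        (∀ q, (halfA N).HasEigenvector lam (b q) ∧ (halfA' N).HasEigenvector lam (b q)) ∧
        LinearIndependent ℂ b ∧
        (halfA N).eigenspace lam = Submodule.span ℂ (Set.range b) ∧
        (halfA' N).eigenspace lam = Submodule.span ℂ (Set.range b)) ∧
    -- roots of `U_N` that are not roots of `U_1, …, U_{N-1}`
    (∀ lam : ℂ, chebU N lam = 0 → (∀ r, 1 ≤ r → r ≤ N - 1 → chebU r lam ≠ 0) →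
      ∃ b : Word N → ℂ,
        (∀ c, IsTopVector N lam c ↔ c = b) ∧
        (halfA' N).HasEigenvector lam b ∧
        (halfA' N).eigenspace lam = Submodule.span ℂ {b}) ∧
    -- the eigenvalue `1`
    (∃ b : Word N → ℂ,
      (∀ c, IsStationaryVector N c ↔ c = b) ∧
      (halfA' N).HasEigenvector 1 b ∧
      (halfA' N).eigenspace 1 = Submodule.span ℂ {b}) := by
  refine ⟨fun m lam hm hroot => ?_, fun ℓ lam hℓ hroot hU => ?_, ?_⟩
  · obtain ⟨ℓ, hℓm, hℓ, hU⟩ := exists_minimal_root hroot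
    have hℓN : ℓ + 2 ≤ N := by omega
    -- Any prefix would do; one eigenvector suffices to exhibit the eigenvalue.
    obtain ⟨h1, h2⟩ := hasEigenvector_prefixVec hℓN hℓ hU fun _ => false
    obtain ⟨h3, h4⟩ := eigenspace_eq_span_prefixVec hℓN hℓ hU
    refine ⟨Module.End.hasEigenvalue_of_hasEigenvector h1,
      Module.End.hasEigenvalue_of_hasEigenvector h2, fun v => ?_⟩
    rw [Module.End.hasEigenvector_iff, Module.End.hasEigenvector_iff, h3, h4]
  · obtain ⟨h1, h2⟩ := eigenspace_eq_span_prefixVec hℓ hroot hU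
    exact ⟨fun q => prefixVec lam q, fun q c => isPrefixVector_iff hℓ hU q c,
      hasEigenvector_prefixVec hℓ hroot hU, linearIndependent_prefixVec hℓ, h1, h2⟩
  · obtain ⟨n, rfl⟩ : ∃ n, N = n + 1 := ⟨N - 1, by omega⟩
    refine ⟨fun lam hroot hU => ?_, ?_⟩
    · exact ⟨_, isTopVector_iff hroot hU, twoSidedSol_spec hU (by rw [hroot, zero_sub])
        (neg_chebU_sq_of_root hroot)⟩
    · refine ⟨_, isStationaryVector_iff, twoSidedSol_spec (fun r _ _ => ?_) ?_ (one_pow 2)⟩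
      · rw [chebU_at_one]
        exact Nat.cast_add_one_ne_zero r
      · rw [chebU_at_one, chebU_at_one]
        push_cast
        ring
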